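/- Throughout, for a Euclidean ball $B=B(p,r)\subset\mathbb C^n$ ($n\ge1$, $r>0$) and $\eta>1$, write $B^\eta=B(p,r/\eta)$. For a function $f$ and a set $A$ put $M_A(f)=\max_{\bar A}|f|$. Let $R$ be holomorphic on a neighbourhood of $\bar B$ and not identically zero on $B$. Its Bernstein index with gap $2$ is $$\mathfrak B=\mathfrak B_B^2(R)=\sup_{L}\ \ln\frac{M_{B\cap L}(R)}{M_{\bar B^{2}\cap L}(R)}\in[0,\infty],$$ where $L$ ranges over the complex lines through $p$ on which $R$ does not vanish identically. Let $X_R=B\cap\{R=0\}$. A Weierstrass polydisc for $X_R$ is a polydisc $\Delta=\Delta_z\times\Delta_w$ in a coordinate system $(z,w)\in\mathbb C^{n-1}\times\mathbb C$ obtained from the standard coordinates by an affine unitary transformation, such that $\bar\Delta\subset B$ and $(\bar\Delta_z\times\partial\Delta_w)\cap X_R=\emptyset$. Its degree $e(X_R,\Delta)$ is the degree of the branched cover $X_R\cap\Delta\to\Delta_z$, i.e. the number of points in a generic fibre, which is the largest number of points in a fibre. Its degree with multiplicities, in which each component of $X_R$ counts with its multiplicity as a zero of $R$, is the number of zeros of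 $w\mapsto R(z,w)$ in $\Delta_w$, counted with multiplicity, which is the same for all $z\in\Delta_z$. Proposition. There are an absolute constant $A$ and, for each $n\ge1$, a constant $C_n$ depending only on $n$ such that for all $B\subset\mathbb C^n$ and $R$ as above there exist a Weierstrass polydisc $\Delta$ for $X_R$ and $\eta>1$ with $$B^\eta\subset\Delta\subset B,\qquad \eta\le e^{C_n(1+\mathfrak B)},$$ $$e(X_R,\Delta)\le A\,\mathfrak B,$$ and the last bound also holds for the degree of $X_R$ with multiplicities. -/

import Mathlib

open scoped ENNReal NNReal

noncomputable section

/-- `M_A(f)`, the maximum of `|f|` on the closure of `A`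
(it is attained whenever `f` is continuous on the closure of `A` and that closure is compact). -/
def maxModulus {E : Type*} [TopologicalSpace E] (A : Set E) (f : E → ℂ) : ℝ :=
  sSup ((fun x => ‖f x‖) '' closure A)

/-- The Bernstein index `ln (M_U(f) / M_K(f))` of `f` with respect to the pair `K ⊆ U`. -/
def bernsteinIndex {E : Type*} [TopologicalSpace E] (K U : Set E) (f : E → ℂ) : ℝ :=
  Real.log (maxModulus U f / maxModulus K f)

/-- The complex line through `p` with direction `v` (`v ≠ 0`). -/
def complexLine {E : Type*} [AddCommGroup E] [Module ℂ E] (p v : E) : Set E :=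
  {x | ∃ t : ℂ, x = p + t • v}

/-- The Bernstein index of `F` with respect to a ball `B = B(p, r)` and `K ⊆ B`: the supremum of the
Bernstein indices of the restrictions of `F` to the pairs `K ∩ L ⊆ B ∩ L`, where `L` ranges over the
complex lines through the center `p`. Lines on which `F` vanishes identically, where the quotient of
the maxima is `0 / 0`, are left out. All the indices are nonnegative because `K ⊆ B`, so the
supremum is taken in `[0, ∞]`. -/
def ballBernsteinIndex {n : ℕ} (K : Set (EuclideanSpace ℂ (Fin n)))
    (p : EuclideanSpace ℂ (Fin n)) (r : ℝ) (F : EuclideanSpace ℂ (Fin n) → ℂ) : ℝ≥0∞ :=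
  ⨆ (v : EuclideanSpace ℂ (Fin n)) (_ : v ≠ 0)
    (_ : ∃ x ∈ Metric.ball p r ∩ complexLine p v, F x ≠ 0),
    ENNReal.ofReal
      (bernsteinIndex (K ∩ complexLine p v) (Metric.ball p r ∩ complexLine p v) F)

/-- The index `𝔅_B^η(F)` of the ball `B = B(p, r)` with gap `η > 1`: here `K` is the closure of
`B^η`, the ball shrunk about its center by the factor `η`. -/
def gapBernsteinIndex {n : ℕ} (η : ℝ) (p : EuclideanSpace ℂ (Fin n)) (r : ℝ)
    (F : EuclideanSpace ℂ (Fin n) → ℂ) : ℝ≥0∞ :=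
  ballBernsteinIndex (Metric.closedBall p (r / η)) p r F

/-- A polydisc `Δ = Δ_z × Δ_w` in `ℂⁿ`, in a standard coordinate system `x = z × w`, that is, one
obtained from the standard coordinates by an affine unitary transformation. Here `z` has `m` and
`w` has `k` coordinates (so that necessarily `n = m + k`). -/
structure StdPolydisc (n m k : ℕ) where
  coord : EuclideanSpace ℂ (Fin n) ≃ᵃⁱ[ℂ] EuclideanSpace ℂ (Fin m ⊕ Fin k)
  zCenter : Fin m → ℂ
  wCenter : Fin k → ℂ
  zRadius : Fin m → ℝ
  wRadius : Fin k → ℝ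
  zRadius_pos : ∀ i, 0 < zRadius i
  wRadius_pos : ∀ j, 0 < wRadius j

namespace StdPolydisc

variable {n m k : ℕ} (Δ : StdPolydisc n m k)

/-- The projection `π_z`. -/
def projZ (x : EuclideanSpace ℂ (Fin n)) : Fin m → ℂ := fun i => Δ.coord x (Sum.inl i)

/-- The projection to the `w`-coordinates. -/
def projW (x : EuclideanSpace ℂ (Fin n)) : Fin k → ℂ := fun j => Δ.coord x (Sum.inr j)

/-- The point of `ℂⁿ` with coordinates `z × w`. -/
def point (z : Fin m → ℂ) (w : Fin k → ℂ) : EuclideanSpace ℂ (Fin n) :=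
  Δ.coord.symm (WithLp.toLp 2 (Sum.elim z w))

/-- The base `Δ_z`. -/
def base : Set (Fin m → ℂ) := {z | ∀ i, ‖z i - Δ.zCenter i‖ < Δ.zRadius i}

/-- The fiber `Δ_w`. -/
def fiber : Set (Fin k → ℂ) := {w | ∀ j, ‖w j - Δ.wCenter j‖ < Δ.wRadius j}

/-- The polydisc `Δ_z × Δ_w` as a subset of `ℂⁿ`. -/
def carrier : Set (EuclideanSpace ℂ (Fin n)) := {x | Δ.projZ x ∈ Δ.base ∧ Δ.projW x ∈ Δ.fiber}

/-- `Δ` is a Weierstrass polydisc for the analytic subset `X` of `Ω`, of pure dimension `m`: the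
closure of `Δ` lies in `Ω`, and `X` does not meet `closure Δ_z × ∂Δ_w`. -/
def IsWeierstrass (Ω X : Set (EuclideanSpace ℂ (Fin n))) : Prop :=
  closure Δ.carrier ⊆ Ω ∧
    {x | Δ.projZ x ∈ closure Δ.base ∧ Δ.projW x ∈ frontier Δ.fiber} ∩ X = ∅

/-- The degree `e(X, Δ)` of the branched cover `π_z : X ∩ Δ → Δ_z`: the number of points in a
generic fiber, which is the largest number of points in a fiber. -/
def degree (X : Set (EuclideanSpace ℂ (Fin n))) : ℕ∞ :=
  ⨆ z ∈ Δ.base, (X ∩ Δ.carrier ∩ {x | Δ.projZ x = z}).encard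

end StdPolydisc

/-- `g` has finitely many zeros in `D`, and there are `e` of them when each is counted with its
multiplicity. -/
def HasZeroCount (g : ℂ → ℂ) (D : Set ℂ) (e : ℕ) : Prop :=
  ∃ s : Finset ℂ, (∀ w, w ∈ s ↔ w ∈ D ∧ g w = 0) ∧ ∑ w ∈ s, analyticOrderAt g w = (e : ℕ∞)

/-- `e` is the degree over `Δ_z` of the hypersurface `{R = 0}` with its cycle structure, where each
component counts with its multiplicity as a zero of `R`: the projection `π_z` from `{R = 0} ∩ Δ` to
`Δ_z` is `e`-to-one when the points over `z` are counted with their multiplicities as zeros of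
`w ↦ R(z, w)` in `Δ_w`. -/
def StdPolydisc.HasCycleDegree {n m : ℕ} (Δ : StdPolydisc n m 1)
    (R : EuclideanSpace ℂ (Fin n) → ℂ) (e : ℕ) : Prop :=
  ∀ z ∈ Δ.base, HasZeroCount (fun w => R (Δ.point z fun _ => w)) {w | (fun _ => w) ∈ Δ.fiber} e

end

/-! Only one line matters: the line through `p` and a point where `|R|` attains its maximum `M` over
the closed ball. If `f` is the restriction of `R` to it and `b` is its Bernstein index, then `b ≤
𝔅`, while `M` bounds `|R|` on the whole ball and not merely on the line.

One-variable part (`exists_circle_exp_le_norm`). After scaling, `|f| ≤ 1` on the unit disc and `|f|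
≥ exp (-b)` somewhere in the half disc. Replacing each of the `N` zeros in the disc of radius `3/4`
by its reflected factor gives a function `H`, still bounded by one and free of zeros on that disc.
Each exchange gains a fixed factor on the half disc, so `N` is `O(b)`. Harnack's inequality bounds
`|H|` below by `exp (-25 b)`, and Chebyshev's extremal property supplies a circle `|w| = ρ` far
enough from the zeros. Hence `|f| ≥ M exp (-c b)` on a circle of radius between `r/4` and `r/2`.

Several variables (`OrthonormalBasis.isWeierstrass_stdPolydisc`). Since `|R| ≤ M`, the Schwarz lemma
bounds the change of `R` across the line by `4 M / r` times the displacement. A base of radius a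
small multiple of `r exp (-c b)` therefore keeps `R` nonzero over the circle, and by Rouché every
fibre has as many zeros as `f`. -/

/-! ### Zeros in one variable: factorisation, argument principle, Rouché. -/

theorem AnalyticOnNhd.finite_zeros_of_isCompact {f : ℂ → ℂ} {U K : Set ℂ}
    (hf : AnalyticOnNhd ℂ f U) (hU : IsPreconnected U) (hne : ∃ x ∈ U, f x ≠ 0)
    (hK : IsCompact K) (hKU : K ⊆ U) : {w | w ∈ K ∧ f w = 0}.Finite := by
  by_contra hinf
  obtain ⟨x, hxK, hx⟩ := Set.Infinite.exists_accPt_of_subset_isCompact hinf hK fun w hw => hw.1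
  obtain ⟨y, hy, hfy⟩ := hne
  refine hfy (hf.eqOn_zero_of_preconnected_of_frequently_eq_zero hU (hKU hxK) ?_ hy)
  exact (accPt_iff_frequently_nhdsNE.1 hx).mono fun w hw => hw.2

theorem AnalyticOnNhd.analyticOrderAt_ne_top_of_exists_ne_zero {f : ℂ → ℂ} {U : Set ℂ}
    (hf : AnalyticOnNhd ℂ f U) (hU : IsPreconnected U) (hne : ∃ x ∈ U, f x ≠ 0) {a : ℂ}
    (ha : a ∈ U) : analyticOrderAt f a ≠ ⊤ := by
  intro h
  obtain ⟨y, hy, hfy⟩ := hne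
  exact hfy (hf.eqOn_zero_of_preconnected_of_eventuallyEq_zero hU ha (analyticOrderAt_eq_top.1 h) hy)

open Topology in
/-- A zero of finite order can be divided out of an analytic function. -/
theorem AnalyticOnNhd.exists_eq_sub_pow_mul {f : ℂ → ℂ} {U : Set ℂ} (hf : AnalyticOnNhd ℂ f U)
    {a : ℂ} (ha : a ∈ U) (hord : analyticOrderAt f a ≠ ⊤) :
    ∃ h : ℂ → ℂ, AnalyticOnNhd ℂ h U ∧ h a ≠ 0 ∧
      ∀ w, f w = (w - a) ^ analyticOrderNatAt f a * h w := by
  classical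
  obtain ⟨g, hg, hga, hfg⟩ := (hf a ha).analyticOrderAt_ne_top.1 hord
  set n := analyticOrderNatAt f a
  have hpt : ∀ w, w ≠ a → f w = (w - a) ^ n * (f w / (w - a) ^ n) := fun w hw => by
    have : (w - a) ^ n ≠ 0 := pow_ne_zero _ (sub_ne_zero.2 hw)
    field_simp
  refine ⟨Function.update (fun w => f w / (w - a) ^ n) a (g a), ?_, by simpa using hga, ?_⟩
  · intro w hw
    rcases eq_or_ne w a with rfl | hwa
    · refine hg.congr ?_
      filter_upwards [hfg] with z hz
      rcases eq_or_ne z w with rfl | hzw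
      · simp
      · have : (z - w) ^ n ≠ 0 := pow_ne_zero _ (sub_ne_zero.2 hzw)
        rw [Function.update_of_ne hzw, hz, smul_eq_mul]
        field_simp
    · have hne : (w - a) ^ n ≠ 0 := pow_ne_zero _ (sub_ne_zero.2 hwa)
      have h1 : AnalyticAt ℂ (fun w => f w / (w - a) ^ n) w :=
        (hf w hw).div (by fun_prop) hne
      refine h1.congr ?_
      filter_upwards [isOpen_ne.mem_nhds hwa] with z hz
      rw [Function.update_of_ne hz]
  · intro w
    rcases eq_or_ne w a with rfl | hwa
    · simpa using hfg.self_of_nhds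
    · rw [Function.update_of_ne hwa]
      exact hpt w hwa

/-- Finitely many zeros of finite order can be divided out of an analytic function. -/
theorem AnalyticOnNhd.exists_eq_prod_mul {U : Set ℂ} (s : Finset ℂ) :
    ∀ {f : ℂ → ℂ}, AnalyticOnNhd ℂ f U → (↑s ⊆ U) → (∀ a ∈ s, analyticOrderAt f a ≠ ⊤) →
    ∃ h : ℂ → ℂ, AnalyticOnNhd ℂ h U ∧ (∀ a ∈ s, h a ≠ 0) ∧
      ∀ w, f w = (∏ a ∈ s, (w - a) ^ analyticOrderNatAt f a) * h w := by
  classical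
  induction s using Finset.induction_on with
  | empty => exact fun {f} hf _ _ => ⟨f, hf, by simp, by simp⟩
  | insert a s has ih =>
    intro f hf hs hord
    obtain ⟨g, hg, hga, hfg⟩ :=
      hf.exists_eq_sub_pow_mul (hs (by simp)) (hord a (by simp))
    have hmul : f = (fun w => (w - a) ^ analyticOrderNatAt f a) * g := funext hfg
    -- Dividing out the zero at `a` leaves the orders at the other points unchanged, so the
    -- induction can continue with `g`.
    have hog : ∀ b ∈ s, analyticOrderAt g b = analyticOrderAt f b := fun b hb => by
      have hba : b ≠ a := fun h => has (h ▸ hb)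
      have h0 : analyticOrderAt (fun w => (w - a) ^ analyticOrderNatAt f a) b = 0 :=
        (AnalyticAt.analyticOrderAt_eq_zero (by fun_prop)).2 (pow_ne_zero _ (sub_ne_zero.2 hba))
      conv_rhs => rw [hmul]
      rw [analyticOrderAt_mul (by fun_prop) (hg b (hs (by simp [hb]))), h0, zero_add]
    obtain ⟨h, hh, hhs, hgh⟩ := ih hg (fun b hb => hs (by simp [Finset.mem_coe.1 hb]))
      fun b hb => by rw [hog b hb]; exact hord b (by simp [hb])
    refine ⟨h, hh, fun b hb => ?_, fun w => ?_⟩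
    · rcases Finset.mem_insert.1 hb with rfl | hb
      · intro h0
        exact hga (by rw [hgh, h0, mul_zero])
      · exact hhs b hb
    · have : ∏ b ∈ s, (w - b) ^ analyticOrderNatAt f b
          = ∏ b ∈ s, (w - b) ^ analyticOrderNatAt g b :=
        Finset.prod_congr rfl fun b hb => by
          rw [analyticOrderNatAt, analyticOrderNatAt, hog b hb]
      rw [Finset.prod_insert has, this, mul_assoc, ← hgh, ← hfg]

/-- The argument principle: an analytic function without zeros on a circle has finitely many zeros
inside, and the integral of its logarithmic derivative counts them. -/
theorem exists_hasZeroCount_of_ne_zero_on_sphere {f : ℂ → ℂ} {c : ℂ} {ρ : ℝ} (hρ : 0 < ρ)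
    (hf : AnalyticOnNhd ℂ f (Metric.closedBall c ρ)) (hne : ∀ w ∈ Metric.sphere c ρ, f w ≠ 0) :
    ∃ e : ℕ, HasZeroCount f (Metric.ball c ρ) e ∧
      (∮ w in C(c, ρ), logDeriv f w) = 2 * Real.pi * Complex.I * e := by
  have hpre : IsPreconnected (Metric.closedBall c ρ) := (convex_closedBall c ρ).isPreconnected
  obtain ⟨x, hx⟩ : (Metric.sphere c ρ).Nonempty := NormedSpace.sphere_nonempty.2 hρ.le
  have hex : ∃ x ∈ Metric.closedBall c ρ, f x ≠ 0 :=
    ⟨x, Metric.sphere_subset_closedBall hx, hne x hx⟩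
  have hfin := hf.finite_zeros_of_isCompact hpre hex (isCompact_closedBall c ρ) subset_rfl
  have htop := fun a (ha : a ∈ Metric.closedBall c ρ) =>
    hf.analyticOrderAt_ne_top_of_exists_ne_zero hpre hex ha
  set s := hfin.toFinset
  have hs : ∀ w, w ∈ s ↔ w ∈ Metric.ball c ρ ∧ f w = 0 := fun w => by
    simp only [s, Set.Finite.mem_toFinset, Set.mem_ofPred_eq]
    refine ⟨fun h => ⟨?_, h.2⟩, fun h => ⟨Metric.ball_subset_closedBall h.1, h.2⟩⟩
    rcases (Metric.mem_closedBall.1 h.1).lt_or_eq with h1 | h1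
    · exact h1
    · exact absurd h.2 (hne w h1)
  have hsU : ∀ a ∈ s, a ∈ Metric.closedBall c ρ := fun a ha =>
    Metric.ball_subset_closedBall ((hs a).1 ha).1
  obtain ⟨h, hh, hhs, hfh⟩ := AnalyticOnNhd.exists_eq_prod_mul s hf (fun a ha => hsU a ha)
    fun a ha => htop a (hsU a ha)
  have hh0 : ∀ w ∈ Metric.closedBall c ρ, h w ≠ 0 := fun w hw h0 => by
    by_cases hws : w ∈ s
    · exact hhs w hws h0
    · exact hws (hfin.mem_toFinset.2 ⟨hw, by rw [hfh w, h0, mul_zero]⟩)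
  refine ⟨∑ a ∈ s, analyticOrderNatAt f a, ⟨s, hs, ?_⟩, ?_⟩
  · push_cast
    exact Finset.sum_congr rfl fun a ha => (Nat.cast_analyticOrderNatAt (htop a (hsU a ha))).symm
  · have hcont : ∀ a ∈ s, ContinuousOn (fun w => (w - a)⁻¹) (Metric.sphere c ρ) := fun a ha =>
      ContinuousOn.inv₀ (by fun_prop) fun w hw h0 =>
        hne w hw ((sub_eq_zero.1 h0).symm ▸ ((hs a).1 ha).2)
    -- The cofactor `h` has no zeros, so by Cauchy it contributes nothing; each zero `a` contributes
    -- `2πi` times its order.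
    have hlog : AnalyticOnNhd ℂ (logDeriv h) (Metric.closedBall c ρ) := fun w hw =>
      (hh w hw).deriv.div (hh w hw) (hh0 w hw)
    have hzero : (∮ w in C(c, ρ), logDeriv h w) = 0 :=
      Complex.circleIntegral_eq_zero_of_differentiable_on_off_countable hρ.le Set.countable_empty
        hlog.continuousOn fun w hw => (hlog w (Metric.ball_subset_closedBall hw.1)).differentiableAt
    have heq : Set.EqOn (logDeriv f)
        (fun w => (∑ a ∈ s, (analyticOrderNatAt f a : ℂ) * (w - a)⁻¹) + logDeriv h w)
        (Metric.sphere c ρ) := fun w hw => by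
      have hwa : ∀ a ∈ s, w - a ≠ 0 := fun a ha h0 =>
        hne w hw ((sub_eq_zero.1 h0).symm ▸ ((hs a).1 ha).2)
      have hprod : ∏ a ∈ s, (w - a) ^ analyticOrderNatAt f a ≠ 0 :=
        Finset.prod_ne_zero_iff.2 fun a ha => pow_ne_zero _ (hwa a ha)
      have hwc := Metric.sphere_subset_closedBall hw
      conv_lhs => rw [show f = fun w => (∏ a ∈ s, (w - a) ^ analyticOrderNatAt f a) * h w from
        funext hfh]
      rw [logDeriv_mul w hprod (hh0 w hwc) (by fun_prop) (hh w hwc).differentiableAt]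
      congr 1
      rw [logDeriv_prod (f := fun a w => (w - a) ^ analyticOrderNatAt f a) (fun a ha => pow_ne_zero _ (hwa a ha)) (fun a ha => by fun_prop)]
      refine Finset.sum_congr rfl fun a ha => ?_
      rw [logDeriv_fun_pow (by fun_prop)]
      simp [logDeriv_apply]
    rw [circleIntegral.integral_congr hρ.le heq, circleIntegral.integral_add, hzero, add_zero,
      circleIntegral.integral_fun_sum]
    · push_cast
      rw [Finset.mul_sum]
      refine Finset.sum_congr rfl fun a ha => ?_
      rw [circleIntegral.integral_const_mul,
        circleIntegral.integral_sub_inv_of_mem_ball ((hs a).1 ha).1, mul_comm]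
    · exact fun a ha => (continuousOn_const.mul (hcont a ha)).circleIntegrable hρ.le
    · exact (continuousOn_finsetSum _ fun a ha =>
        continuousOn_const.mul (hcont a ha)).circleIntegrable hρ.le
    · exact (hlog.continuousOn.mono Metric.sphere_subset_closedBall).circleIntegrable hρ.le

/-- **Rouché's theorem** for a circle. -/
theorem HasZeroCount.of_norm_sub_lt_norm {f g : ℂ → ℂ} {c : ℂ} {ρ : ℝ} {e : ℕ} (hρ : 0 < ρ)
    (hf : AnalyticOnNhd ℂ f (Metric.closedBall c ρ))
    (hg : AnalyticOnNhd ℂ g (Metric.closedBall c ρ))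
    (hfg : ∀ w ∈ Metric.sphere c ρ, ‖g w - f w‖ < ‖f w‖)
    (he : HasZeroCount f (Metric.ball c ρ) e) : HasZeroCount g (Metric.ball c ρ) e := by
  have hf0 : ∀ w ∈ Metric.sphere c ρ, f w ≠ 0 := fun w hw =>
    norm_pos_iff.1 ((norm_nonneg _).trans_lt (hfg w hw))
  have hg0 : ∀ w ∈ Metric.sphere c ρ, g w ≠ 0 := fun w hw h0 => by
    simpa [h0] using hfg w hw
  obtain ⟨m, hm, hm'⟩ := exists_hasZeroCount_of_ne_zero_on_sphere hρ hf hf0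
  obtain ⟨n, hn, hn'⟩ := exists_hasZeroCount_of_ne_zero_on_sphere hρ hg hg0
  have hem : e = m := by
    obtain ⟨s, hs, hse⟩ := he
    obtain ⟨t, ht, hte⟩ := hm
    have : s = t := Finset.ext fun w => by rw [hs, ht]
    subst this
    exact_mod_cast hse.symm.trans hte
  -- On the circle `g / f` lies within distance less than `1` of `1`, so its principal logarithm is
  -- a primitive of the difference of the logarithmic derivatives.
  have hslit : ∀ w ∈ Metric.sphere c ρ, g w / f w ∈ Complex.slitPlane := fun w hw => by
    left
    have h1 : ‖g w / f w - 1‖ < 1 := by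
      rw [div_sub_one (hf0 w hw), norm_div, div_lt_one (norm_pos_iff.2 (hf0 w hw))]
      exact hfg w hw
    have h2 := (Complex.abs_re_le_norm _).trans_lt h1
    rw [abs_lt] at h2
    simp only [Complex.sub_re, Complex.one_re] at h2
    linarith
  have hzero : (∮ w in C(c, ρ), (logDeriv g w - logDeriv f w)) = 0 := by
    refine circleIntegral.integral_eq_zero_of_hasDerivWithinAt
      (f := fun w => Complex.log (g w / f w)) hρ.le fun w hw => ?_
    have hwc := Metric.sphere_subset_closedBall hw
    have hd := (((hg w hwc).differentiableAt.hasDerivAt.div (hf w hwc).differentiableAt.hasDerivAt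
      (hf0 w hw)).clog (hslit w hw)).hasDerivWithinAt (s := Metric.sphere c ρ)
    refine hd.congr_deriv ?_
    have := hf0 w hw
    have := hg0 w hw
    simp only [logDeriv_apply, Pi.div_apply]
    field_simp
  have hint : ∀ k : ℂ → ℂ, AnalyticOnNhd ℂ k (Metric.closedBall c ρ) →
      (∀ w ∈ Metric.sphere c ρ, k w ≠ 0) → CircleIntegrable (logDeriv k) c ρ := fun k hk hk0 => by
    refine ContinuousOn.circleIntegrable hρ.le fun w hw => ?_
    have hkw := hk w (Metric.sphere_subset_closedBall hw)
    exact (hkw.deriv.div hkw (hk0 w hw)).continuousAt.continuousWithinAt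
  rw [circleIntegral.integral_sub (hint g hg hg0) (hint f hf hf0), hm', hn', ← mul_sub,
    mul_eq_zero, sub_eq_zero] at hzero
  have hnm : n = m := by
    rcases hzero with h | h
    · exact absurd h (by simp [Real.pi_ne_zero])
    · exact_mod_cast h
  rw [hem, ← hnm]
  exact hn

/-! ### Lower bounds for bounded holomorphic functions on a disc. -/

open InnerProductSpace Metric Set in
/-- **Harnack's inequality** on a disc, in the form of a two-sided comparison with the mean. -/
theorem InnerProductSpace.HarmonicOnNhd.harnack {u : ℂ → ℝ} {c w : ℂ} {R : ℝ}
    (hu : HarmonicOnNhd u (closedBall c R)) (hu0 : ∀ z ∈ sphere c R, 0 ≤ u z) (hw : w ∈ ball c R) :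
    (R - ‖w - c‖) / (R + ‖w - c‖) * Real.circleAverage u c R ≤ u w ∧
      u w ≤ (R + ‖w - c‖) / (R - ‖w - c‖) * Real.circleAverage u c R := by
  have hR : 0 < R := pos_of_mem_ball hw
  have habs : |R| = R := abs_of_pos hR
  have hcont : ContinuousOn u (sphere c |R|) := fun z hz =>
    (hu z (sphere_subset_closedBall (habs ▸ hz))).1.continuousAt.continuousWithinAt
  have hker := continuousOn_herglotzRieszKernel_sphere hw
  have hint : CircleIntegrable ((Complex.re ∘ herglotzRieszKernel c w) • u) c R :=
    ContinuousOn.circleIntegrable' ((Complex.continuous_re.comp_continuousOn hker).smul hcont)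
  -- Poisson's formula; the two factors are the extreme values of the Poisson kernel on the circle.
  rw [← hu.circleAverage_re_herglotzRieszKernel_smul hw, ← smul_eq_mul, ← smul_eq_mul,
    ← Real.circleAverage_smul, ← Real.circleAverage_smul]
  have hu' : CircleIntegrable u c R := ContinuousOn.circleIntegrable' hcont
  refine ⟨Real.circleAverage_mono (hu'.const_smul) hint fun z hz => ?_,
    Real.circleAverage_mono hint (hu'.const_smul) fun z hz => ?_⟩
  · rw [habs] at hz
    exact mul_le_mul_of_nonneg_right (le_re_herglotzRieszKernel hz hw) (hu0 z hz)
  · rw [habs] at hz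
    exact mul_le_mul_of_nonneg_right (re_herglotzRieszKernel_le hz hw) (hu0 z hz)

open InnerProductSpace Metric Set in
/-- A holomorphic function without zeros and bounded by one on a disc of radius `3 / 4`, which is
not small somewhere in the disc of radius `1 / 2`, is nowhere small there. -/
theorem norm_ge_exp_of_ne_zero {H : ℂ → ℂ} (hH : AnalyticOnNhd ℂ H (closedBall 0 (3 / 4)))
    (hH0 : ∀ w ∈ closedBall (0 : ℂ) (3 / 4), H w ≠ 0)
    (hH1 : ∀ w ∈ closedBall (0 : ℂ) (3 / 4), ‖H w‖ ≤ 1)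
    {b : ℝ} {w₀ w : ℂ} (hw₀ : ‖w₀‖ ≤ 1 / 2) (hb : Real.exp (-b) ≤ ‖H w₀‖) (hw : ‖w‖ ≤ 1 / 2) :
    Real.exp (-(25 * b)) ≤ ‖H w‖ := by
  -- `-log |H|` is harmonic and nonnegative. For radii `3/4` and `1/2` the Harnack ratio is `5`: at
  -- `w₀` it bounds the mean by `5 b`, and at `w` it costs another factor `5`.
  set u : ℂ → ℝ := -fun z => Real.log ‖H z‖ with hu_def
  have hu : HarmonicOnNhd u (closedBall 0 (3 / 4)) := HarmonicOnNhd.neg fun z hz =>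
    (hH z hz).harmonicAt_log_norm (hH0 z hz)
  have hu0 : ∀ z ∈ closedBall (0 : ℂ) (3 / 4), 0 ≤ u z := fun z hz => by
    simpa [hu_def] using Real.log_nonpos (norm_nonneg _) (hH1 z hz)
  have hmem : ∀ z : ℂ, ‖z‖ ≤ 1 / 2 → z ∈ ball (0 : ℂ) (3 / 4) := fun z hz => by
    rw [mem_ball_zero_iff]; linarith
  have h1 := (hu.harnack (fun z hz => hu0 z (sphere_subset_closedBall hz)) (hmem w₀ hw₀)).1
  have h2 := (hu.harnack (fun z hz => hu0 z (sphere_subset_closedBall hz)) (hmem w hw)).2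
  have havg : 0 ≤ Real.circleAverage u 0 (3 / 4) := Real.circleAverage_nonneg_of_nonneg
    fun z hz => hu0 z (sphere_subset_closedBall (by rwa [abs_of_pos (by norm_num)] at hz))
  rw [sub_zero] at h1 h2
  have h3 : (1 : ℝ) / 5 ≤ (3 / 4 - ‖w₀‖) / (3 / 4 + ‖w₀‖) := by
    rw [div_le_div_iff₀ (by norm_num) (by positivity)]; linarith
  have h4 : (3 / 4 + ‖w‖) / (3 / 4 - ‖w‖) ≤ 5 := by
    rw [div_le_iff₀ (by linarith)]; linarith
  have h5 : u w₀ ≤ b := by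
    have := (Real.le_log_iff_exp_le (norm_pos_iff.2 (hH0 w₀ (ball_subset_closedBall (hmem w₀ hw₀))))).2 hb
    simp only [hu_def, Pi.neg_apply]
    linarith
  have h6 : u w ≤ 25 * b := by
    have := mul_le_mul_of_nonneg_right h3 havg
    have := mul_le_mul_of_nonneg_right h4 havg
    linarith
  rw [← Real.le_log_iff_exp_le (norm_pos_iff.2 (hH0 w (ball_subset_closedBall (hmem w hw))))]
  simp only [hu_def, Pi.neg_apply] at h6
  linarith

open Polynomial in
/-- A monic real polynomial of degree `N` is at least `2⁻ᴺ` somewhere on `[-1, 1]`. -/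
theorem Polynomial.Monic.exists_le_abs_eval {P : ℝ[X]} (hP : P.Monic) :
    ∃ x ∈ Set.Icc (-1 : ℝ) 1, (1 / 2) ^ P.natDegree ≤ |P.eval x| := by
  rcases Nat.eq_zero_or_pos P.natDegree with h0 | hpos
  · rw [hP.natDegree_eq_zero.1 h0]
    exact ⟨0, by norm_num, by simp⟩
  by_contra! hlt
  -- Otherwise `2ᴺ P` is bounded by one on `[-1, 1]` with leading coefficient `2ᴺ`, exceeding the
  -- Chebyshev maximum `2ᴺ⁻¹`; this is where `N ≥ 1` is used.
  have hdeg : (C ((2 : ℝ) ^ P.natDegree) * P).degree ≤ P.natDegree :=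
    by
    rw [degree_C_mul (by positivity)]
    exact degree_le_natDegree
  have := Polynomial.Chebyshev.leadingCoeff_le_of_forall_abs_le_one hdeg fun x hx => by
    have := hlt x hx
    rw [one_div, inv_pow] at this
    rw [eval_mul, eval_C, abs_mul, abs_of_pos (by positivity)]
    calc (2 : ℝ) ^ P.natDegree * |P.eval x| ≤ 2 ^ P.natDegree * (2 ^ P.natDegree)⁻¹ := by gcongr
      _ = 1 := mul_inv_cancel₀ (by positivity)
  rw [leadingCoeff_mul, leadingCoeff_C, hP.leadingCoeff, mul_one] at this
  exact absurd this (not_le.2 (pow_lt_pow_right₀ (by norm_num) (by omega)))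

open Polynomial in
/-- A Cartan type estimate: a product of `N` distances is at least `16⁻ᴺ` at some point of the
interval `[1 / 4, 1 / 2]`. -/
theorem exists_pow_le_prod_abs_sub (s : Finset ℂ) (n : ℂ → ℕ) (x : ℂ → ℝ) :
    ∃ ρ ∈ Set.Icc (1 / 4 : ℝ) (1 / 2),
      (1 / 16 : ℝ) ^ (∑ a ∈ s, n a) ≤ ∏ a ∈ s, |ρ - x a| ^ n a := by
  -- The map `u ↦ (3 + u) / 8` takes `[-1, 1]` onto `[1/4, 1/2]`. Each factor costs `1/8` for the
  -- scaling and `1/2` for the Chebyshev bound.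
  set P : ℝ[X] := ∏ a ∈ s, (X - C (8 * x a - 3)) ^ n a with hPdef
  have hP : P.Monic := monic_prod_of_monic _ _ fun a _ => (monic_X_sub_C _).pow _
  have hdeg : P.natDegree = ∑ a ∈ s, n a := by
    rw [natDegree_prod_of_monic _ _ fun a _ => (monic_X_sub_C _).pow _]
    simp only [(monic_X_sub_C _).natDegree_pow, natDegree_X_sub_C, mul_one]
  obtain ⟨u, hu, hPu⟩ := hP.exists_le_abs_eval
  refine ⟨(3 + u) / 8, ⟨by linarith [hu.1], by linarith [hu.2]⟩, ?_⟩
  have h1 : ∏ a ∈ s, |(3 + u) / 8 - x a| ^ n a = (1 / 8) ^ (∑ a ∈ s, n a) * |P.eval u| := by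
    rw [← Finset.prod_pow_eq_pow_sum, hPdef, eval_prod, Finset.abs_prod, ← Finset.prod_mul_distrib]
    refine Finset.prod_congr rfl fun a _ => ?_
    rw [eval_pow, abs_pow, ← mul_pow, eval_sub, eval_X, eval_C,
      show (3 + u) / 8 - x a = 1 / 8 * (u - (8 * x a - 3)) by ring, abs_mul]
    norm_num
  rw [h1]
  calc (1 / 16 : ℝ) ^ (∑ a ∈ s, n a) = (1 / 8) ^ (∑ a ∈ s, n a) * (1 / 2) ^ (∑ a ∈ s, n a) := by
        rw [← mul_pow]; norm_num
    _ ≤ _ := by rw [hdeg] at hPu; gcongr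

/-- Blaschke factors are unimodular on the unit circle, so exchanging factors does not change
boundary values in modulus. -/
theorem Complex.norm_one_sub_conj_mul_eq {a w : ℂ} (hw : ‖w‖ = 1) :
    ‖1 - starRingEnd ℂ a * w‖ = ‖w - a‖ := by
  have h1 : w * starRingEnd ℂ w = 1 := by
    rw [Complex.mul_conj, Complex.normSq_eq_norm_sq, hw]; simp
  have h2 : w * starRingEnd ℂ (w - a) = 1 - starRingEnd ℂ a * w := by
    rw [map_sub, mul_sub, h1]; ring
  rw [← h2, norm_mul, hw, one_mul, Complex.norm_conj]

/-- The gain per zero. The constant `10/11` is attained at `a = 3/4`, `w = -1/2`, where the two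
moduli are `5/4` and `11/8`. -/
theorem Complex.norm_sub_le_norm_one_sub_conj_mul {a w : ℂ} (ha : ‖a‖ ≤ 3 / 4) (hw : ‖w‖ ≤ 1 / 2) :
    ‖w - a‖ ≤ 10 / 11 * ‖1 - starRingEnd ℂ a * w‖ := by
  have hid : ‖1 - starRingEnd ℂ a * w‖ ^ 2 = ‖w - a‖ ^ 2 + (1 - ‖a‖ ^ 2) * (1 - ‖w‖ ^ 2) := by
    simp only [← Complex.normSq_eq_norm_sq, Complex.normSq_apply, Complex.sub_re, Complex.sub_im,
      Complex.mul_re, Complex.mul_im, Complex.conj_re, Complex.conj_im, Complex.one_re,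
      Complex.one_im]
    ring
  have h1 : ‖w - a‖ ≤ 5 / 4 := (norm_sub_le _ _).trans (by linarith)
  have h2 : ‖w - a‖ ^ 2 ≤ (5 / 4) ^ 2 := by gcongr
  have h3 : ‖a‖ ^ 2 ≤ (3 / 4) ^ 2 := by gcongr
  have h4 : ‖w‖ ^ 2 ≤ (1 / 2) ^ 2 := by gcongr
  have h5 : (7 / 16 : ℝ) * (3 / 4) ≤ (1 - ‖a‖ ^ 2) * (1 - ‖w‖ ^ 2) := by
    apply mul_le_mul <;> linarith
  refine abs_le_of_sq_le_sq' ?_ (by positivity) |>.2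
  rw [mul_pow, hid]
  linarith

open Metric Set in
/-- A holomorphic function bounded by one on the unit disc, and not small somewhere in the disc of
radius `1 / 2`, is not small on a circle about the origin of radius between `1 / 4` and `1 / 2`, and
has few zeros inside it. -/
theorem exists_circle_exp_le_norm {f : ℂ → ℂ} (hf : AnalyticOnNhd ℂ f (closedBall 0 1))
    (hf1 : ∀ w ∈ closedBall (0 : ℂ) 1, ‖f w‖ ≤ 1) {b : ℝ} {w₀ : ℂ} (hw₀ : ‖w₀‖ ≤ 1 / 2)
    (hb : Real.exp (-b) ≤ ‖f w₀‖) :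
    ∃ ρ ∈ Icc (1 / 4 : ℝ) (1 / 2),
      (∀ w : ℂ, ‖w‖ = ρ →
        Real.exp (-((25 + Real.log 32 / Real.log (11 / 10)) * b)) ≤ ‖f w‖) ∧
      ∀ e : ℕ, HasZeroCount f (ball 0 ρ) e → e * Real.log (11 / 10) ≤ b := by
  have hpre : IsPreconnected (closedBall (0 : ℂ) 1) := (convex_closedBall _ _).isPreconnected
  have hex : ∃ x ∈ closedBall (0 : ℂ) 1, f x ≠ 0 :=
    ⟨w₀, by rw [mem_closedBall_zero_iff]; linarith,
      norm_pos_iff.1 ((Real.exp_pos _).trans_le hb)⟩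
  have hsub : closedBall (0 : ℂ) (3 / 4) ⊆ closedBall 0 1 := closedBall_subset_closedBall (by norm_num)
  have hfin := hf.finite_zeros_of_isCompact hpre hex (isCompact_closedBall 0 (3 / 4)) hsub
  have htop := fun a (ha : a ∈ closedBall (0 : ℂ) 1) =>
    hf.analyticOrderAt_ne_top_of_exists_ne_zero hpre hex ha
  set s := hfin.toFinset
  have hs : ∀ w, w ∈ s ↔ w ∈ closedBall (0 : ℂ) (3 / 4) ∧ f w = 0 := fun w => hfin.mem_toFinset
  have hsn : ∀ a ∈ s, ‖a‖ ≤ 3 / 4 := fun a ha => mem_closedBall_zero_iff.1 ((hs a).1 ha).1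
  obtain ⟨h, hh, hhs, hfh⟩ := AnalyticOnNhd.exists_eq_prod_mul s hf
    (fun a ha => hsub ((hs a).1 ha).1) fun a ha => htop a (hsub ((hs a).1 ha).1)
  set n : ℂ → ℕ := analyticOrderNatAt f
  set N := ∑ a ∈ s, n a
  -- This is `f` divided by its Blaschke product over the zeros in the closed disc of radius `3/4`,
  -- so `|H| = |f|` on the unit circle.
  set H : ℂ → ℂ := fun w => (∏ a ∈ s, (1 - starRingEnd ℂ a * w) ^ n a) * h w with hH_def
  have hHan : AnalyticOnNhd ℂ H (closedBall 0 1) := fun w hw =>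
    (Finset.analyticAt_fun_prod _ fun a _ => by fun_prop).mul (hh w hw)
  have hfnorm : ∀ w, ‖f w‖ = (∏ a ∈ s, ‖w - a‖ ^ n a) * ‖h w‖ := fun w => by
    rw [hfh w, norm_mul, norm_prod]; simp only [norm_pow]
  have hHnorm : ∀ w, ‖H w‖ = (∏ a ∈ s, ‖1 - starRingEnd ℂ a * w‖ ^ n a) * ‖h w‖ := fun w => by
    rw [hH_def, norm_mul, norm_prod]; simp only [norm_pow]
  have hH1 : ∀ w ∈ closedBall (0 : ℂ) 1, ‖H w‖ ≤ 1 := fun w hw => by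
    rw [← closure_ball (0 : ℂ) one_ne_zero] at hw
    refine Complex.norm_le_of_forall_mem_frontier_norm_le isBounded_ball
      (DifferentiableOn.diffContOnCl ?_) (fun z hz => ?_) hw
    · rw [closure_ball (0 : ℂ) one_ne_zero]
      exact hHan.differentiableOn
    · rw [frontier_ball (0 : ℂ) one_ne_zero] at hz
      have hz1 : ‖z‖ = 1 := mem_sphere_zero_iff_norm.1 hz
      rw [hHnorm]
      simp only [Complex.norm_one_sub_conj_mul_eq hz1]
      rw [← hfnorm]
      exact hf1 z (sphere_subset_closedBall hz)
  have hH0 : ∀ w ∈ closedBall (0 : ℂ) (3 / 4), H w ≠ 0 := fun w hw => by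
    refine mul_ne_zero (Finset.prod_ne_zero_iff.2 fun a ha => pow_ne_zero _ fun h0 => ?_)
      fun h0 => ?_
    · have h1 : ‖starRingEnd ℂ a * w‖ = 1 := by rw [← sub_eq_zero.1 h0, norm_one]
      rw [norm_mul, Complex.norm_conj] at h1
      have := mul_le_mul (hsn a ha) (mem_closedBall_zero_iff.1 hw) (norm_nonneg _) (by norm_num)
      rw [h1] at this
      norm_num at this
    · by_cases hws : w ∈ s
      · exact hhs w hws h0
      · exact hws ((hs w).2 ⟨hw, by rw [hfh w, h0, mul_zero]⟩)
  have hfH : ‖f w₀‖ ≤ (10 / 11) ^ N * ‖H w₀‖ := by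
    rw [hfnorm, hHnorm, ← mul_assoc, ← Finset.prod_pow_eq_pow_sum, ← Finset.prod_mul_distrib]
    refine mul_le_mul_of_nonneg_right (Finset.prod_le_prod (fun a _ => by positivity)
      fun a ha => ?_) (norm_nonneg _)
    rw [← mul_pow]
    gcongr
    exact Complex.norm_sub_le_norm_one_sub_conj_mul (hsn a ha) hw₀
  have hw₀' : w₀ ∈ closedBall (0 : ℂ) 1 := by rw [mem_closedBall_zero_iff]; linarith
  have hlog : 0 < Real.log (11 / 10) := Real.log_pos (by norm_num)
  have hN : N * Real.log (11 / 10) ≤ b := by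
    have h1 : Real.exp (-b) ≤ (10 / 11) ^ N :=
      hb.trans (hfH.trans (mul_le_of_le_one_right (by positivity) (hH1 w₀ hw₀')))
    rw [← Real.le_log_iff_exp_le (by positivity), Real.log_pow,
      show (10 / 11 : ℝ) = (11 / 10)⁻¹ by norm_num, Real.log_inv] at h1
    linarith
  have hbH : Real.exp (-b) ≤ ‖H w₀‖ := hb.trans (hfH.trans
    (mul_le_of_le_one_left (norm_nonneg _) (pow_le_one₀ (by norm_num) (by norm_num))))
  -- Applied to the moduli of the zeros, since `|w - a| ≥ | |w| - |a| |` holds on the entire circle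
  -- `|w| = ρ`.
  obtain ⟨ρ, hρ, hprod⟩ := exists_pow_le_prod_abs_sub s n fun a => ‖a‖
  refine ⟨ρ, hρ, fun w hw => ?_, fun e he => ?_⟩
  · have hHw := norm_ge_exp_of_ne_zero (fun z hz => hHan z (hsub hz)) hH0
      (fun z hz => hH1 z (hsub hz)) hw₀ hbH (hw.le.trans hρ.2)
    have h1 : ‖H w‖ ≤ 2 ^ N * ‖h w‖ := by
      rw [hHnorm, ← Finset.prod_pow_eq_pow_sum]
      refine mul_le_mul_of_nonneg_right (Finset.prod_le_prod (fun a _ => by positivity)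
        fun a ha => ?_) (norm_nonneg _)
      gcongr
      refine (norm_sub_le _ _).trans ?_
      rw [norm_one, norm_mul, Complex.norm_conj]
      have := mul_le_mul (hsn a ha) (hw.le.trans hρ.2) (norm_nonneg _) (by norm_num)
      linarith
    have h2 : (1 / 16) ^ N ≤ ∏ a ∈ s, ‖w - a‖ ^ n a := by
      refine hprod.trans (Finset.prod_le_prod (fun a _ => by positivity) fun a ha => ?_)
      gcongr
      rw [← hw]
      exact abs_norm_sub_norm_le w a
    -- Returning from `H` to `f` costs, per zero, `1/16` from the distances and `1/2` from the
    -- reflected factors, which are at most `2`.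
    have h3 : (1 / 32) ^ N * ‖H w‖ ≤ ‖f w‖ := by
      calc (1 / 32 : ℝ) ^ N * ‖H w‖ ≤ (1 / 32) ^ N * (2 ^ N * ‖h w‖) := by gcongr
        _ = (1 / 16) ^ N * ‖h w‖ := by rw [← mul_assoc, ← mul_pow]; norm_num
        _ ≤ _ := by rw [hfnorm]; gcongr
    have h4 : Real.exp (-(Real.log 32 / Real.log (11 / 10) * b)) ≤ (1 / 32) ^ N := by
      rw [← Real.le_log_iff_exp_le (by positivity), Real.log_pow, one_div, Real.log_inv]
      have h5 : (N : ℝ) ≤ b / Real.log (11 / 10) := (le_div_iff₀ hlog).2 hN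
      have h6 := mul_le_mul_of_nonneg_right h5 (Real.log_nonneg (by norm_num : (1 : ℝ) ≤ 32))
      calc -(Real.log 32 / Real.log (11 / 10) * b) = -(b / Real.log (11 / 10) * Real.log 32) := by
            ring
        _ ≤ _ := by linarith
    rw [add_mul, neg_add, Real.exp_add, mul_comm]
    exact (mul_le_mul h4 hHw (Real.exp_pos _).le (by positivity)).trans h3
  · obtain ⟨t, ht, hte⟩ := he
    have hts : t ⊆ s := fun a ha => (hs a).2
      ⟨by
        have := mem_ball_zero_iff.1 ((ht a).1 ha).1
        rw [mem_closedBall_zero_iff]; linarith [hρ.2], ((ht a).1 ha).2⟩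
    have hcast : ∑ a ∈ t, analyticOrderAt f a = ((∑ a ∈ t, n a : ℕ) : ℕ∞) := by
      push_cast
      exact Finset.sum_congr rfl fun a ha =>
        (Nat.cast_analyticOrderNatAt (htop a (hsub ((hs a).1 (hts ha)).1))).symm
    rw [hcast] at hte
    have heN : e ≤ N := by
      rw [← Nat.cast_injective (R := ℕ∞) hte]
      exact Finset.sum_le_sum_of_subset hts
    exact (mul_le_mul_of_nonneg_right (by exact_mod_cast heN) hlog.le).trans hN

/-! ### Zero counts under rescaling, and discs of arbitrary radius. -/

theorem HasZeroCount.const_mul_comp_mul {f : ℂ → ℂ} {D : Set ℂ} {e : ℕ} (hf : AnalyticOnNhd ℂ f D)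
    (he : HasZeroCount f D e) {c a : ℂ} (hc : c ≠ 0) (ha : a ≠ 0) :
    HasZeroCount (fun w => c * f (a * w)) {w | a * w ∈ D} e := by
  classical
  obtain ⟨s, hs, hse⟩ := he
  have hinj : Function.Injective fun w : ℂ => a⁻¹ * w := mul_right_injective₀ (inv_ne_zero ha)
  refine ⟨s.image fun w => a⁻¹ * w, fun w => ?_, ?_⟩
  · simp only [Finset.mem_image, Set.mem_ofPred_eq, mul_eq_zero, hc, false_or]
    rw [← hs]
    constructor
    · rintro ⟨x, hx, rfl⟩
      rwa [mul_inv_cancel_left₀ ha]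
    · exact fun hw => ⟨a * w, hw, inv_mul_cancel_left₀ ha w⟩
  · rw [Finset.sum_image fun x _ y _ hxy => hinj hxy, ← hse]
    refine Finset.sum_congr rfl fun w hw => ?_
    have hfw := hf w ((hs w).1 hw).1
    have haw : a * (a⁻¹ * w) = w := mul_inv_cancel_left₀ ha w
    have hlin : AnalyticAt ℂ (fun x : ℂ => a * x) (a⁻¹ * w) := by fun_prop
    have hcomp : AnalyticAt ℂ (f ∘ fun x => a * x) (a⁻¹ * w) :=
      AnalyticAt.comp (by simpa only [haw] using hfw) hlin
    have h0 : analyticOrderAt (fun _ : ℂ => c) (a⁻¹ * w) = 0 :=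
      analyticAt_const.analyticOrderAt_eq_zero.2 hc
    change analyticOrderAt ((fun _ : ℂ => c) * (f ∘ fun x => a * x)) (a⁻¹ * w) = _
    rw [analyticOrderAt_mul analyticAt_const hcomp, h0, zero_add,
      analyticOrderAt_comp_of_deriv_ne_zero hlin (by simpa using ha), haw]

theorem HasZeroCount.exists_card_le {f : ℂ → ℂ} {D : Set ℂ} {e : ℕ} (hf : AnalyticOnNhd ℂ f D)
    (he : HasZeroCount f D e) : ∃ s : Finset ℂ, (∀ w, w ∈ s ↔ w ∈ D ∧ f w = 0) ∧ s.card ≤ e := by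
  obtain ⟨s, hs, hse⟩ := he
  refine ⟨s, hs, ?_⟩
  rw [← Nat.cast_le (α := ℕ∞), ← hse, Finset.card_eq_sum_ones, Nat.cast_sum]
  refine Finset.sum_le_sum fun w hw => ?_
  have hw' := (hs w).1 hw
  rw [Nat.cast_one, Order.one_le_iff_ne_zero]
  exact fun h0 => (hf w hw'.1).analyticOrderAt_eq_zero.1 h0 hw'.2

open Metric Set in
/-- `exists_circle_exp_le_norm` on a disc of radius `r`. -/
theorem exists_circle_exp_mul_le_norm {f : ℂ → ℂ} {r M b : ℝ} (hr : 0 < r) (hM : 0 < M)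
    (hf : AnalyticOnNhd ℂ f (closedBall 0 r)) (hfM : ∀ w ∈ closedBall (0 : ℂ) r, ‖f w‖ ≤ M)
    {t : ℂ} (ht : ‖t‖ ≤ r / 2) (hb : Real.exp (-b) * M ≤ ‖f t‖) :
    ∃ ρ ∈ Icc (r / 4) (r / 2),
      (∀ w : ℂ, ‖w‖ = ρ →
        M * Real.exp (-((25 + Real.log 32 / Real.log (11 / 10)) * b)) ≤ ‖f w‖) ∧
      ∀ e : ℕ, HasZeroCount f (ball 0 ρ) e → e * Real.log (11 / 10) ≤ b := by
  have hr0 : (r : ℂ) ≠ 0 := Complex.ofReal_ne_zero.2 hr.ne'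
  have hM0 : (M : ℂ)⁻¹ ≠ 0 := inv_ne_zero (Complex.ofReal_ne_zero.2 hM.ne')
  have hnM : ‖(M : ℂ)⁻¹‖ = M⁻¹ := by rw [norm_inv, Complex.norm_of_nonneg hM.le]
  have hnr : ∀ w : ℂ, ‖(r : ℂ) * w‖ = r * ‖w‖ := fun w => by
    rw [norm_mul, Complex.norm_of_nonneg hr.le]
  have hmem : ∀ w ∈ closedBall (0 : ℂ) 1, (r : ℂ) * w ∈ closedBall (0 : ℂ) r := fun w hw => by
    rw [mem_closedBall_zero_iff] at hw ⊢
    rw [hnr]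
    exact mul_le_of_le_one_right hr.le hw
  obtain ⟨ρ, hρ, h1, h2⟩ := exists_circle_exp_le_norm (f := fun w => (M : ℂ)⁻¹ * f (r * w))
    (b := b) (w₀ := (r : ℂ)⁻¹ * t)
    (fun w hw => analyticAt_const.mul ((hf _ (hmem w hw)).comp (by fun_prop)))
    (fun w hw => by
      rw [norm_mul, hnM, inv_mul_le_one₀ hM]
      exact hfM _ (hmem w hw))
    (by
      rw [norm_mul, norm_inv, Complex.norm_of_nonneg hr.le, inv_mul_le_iff₀ hr]
      linarith)
    (by
      rw [norm_mul, hnM, mul_inv_cancel_left₀ hr0, le_inv_mul_iff₀ hM]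
      linarith)
  refine ⟨r * ρ, ⟨by nlinarith [hρ.1], by nlinarith [hρ.2]⟩, fun w hw => ?_, fun e he => ?_⟩
  · have := h1 ((r : ℂ)⁻¹ * w) (by
      rw [norm_mul, norm_inv, Complex.norm_of_nonneg hr.le, hw, inv_mul_cancel_left₀ hr.ne'])
    rwa [norm_mul, hnM, mul_inv_cancel_left₀ hr0, le_inv_mul_iff₀ hM] at this
  · refine h2 e ?_
    have hsub : ball (0 : ℂ) (r * ρ) ⊆ closedBall 0 r :=
      ball_subset_closedBall.trans (closedBall_subset_closedBall (by nlinarith [hρ.2]))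
    have := HasZeroCount.const_mul_comp_mul (fun w hw => hf w (hsub hw)) he hM0 hr0
    convert this using 1
    ext w
    rw [mem_ball_zero_iff, mem_ofPred_eq, mem_ball_zero_iff, hnr, mul_lt_mul_iff_right₀ hr]

/-! ### Restriction to complex lines and the Bernstein index. -/

theorem maxModulus_eq_of_isMaxOn {E : Type*} [TopologicalSpace E] {A : Set E} {f : E → ℂ} {x : E}
    (hx : x ∈ closure A) (hmax : ∀ y ∈ closure A, ‖f y‖ ≤ ‖f x‖) : maxModulus A f = ‖f x‖ :=
  IsGreatest.csSup_eq ⟨⟨x, hx, rfl⟩, by rintro _ ⟨y, hy, rfl⟩; exact hmax y hy⟩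

theorem maxModulus_image {E F : Type*} [TopologicalSpace E] [TopologicalSpace F] {i : F → E}
    (hi : Topology.IsClosedEmbedding i) (A : Set F) (f : E → ℂ) :
    maxModulus (i '' A) f = maxModulus A (f ∘ i) := by
  rw [maxModulus, maxModulus, hi.closure_image_eq, Set.image_image]
  rfl

section Line

variable {E : Type*} [NormedAddCommGroup E] [NormedSpace ℂ E] {p v : E}

theorem isometry_add_smul (hv : ‖v‖ = 1) : Isometry fun t : ℂ => p + t • v :=
  Isometry.of_dist_eq fun s t => by
    rw [dist_add_left, dist_eq_norm, ← sub_smul, norm_smul, hv, mul_one, dist_eq_norm]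

theorem ball_inter_complexLine (hv : ‖v‖ = 1) (r : ℝ) :
    Metric.ball p r ∩ complexLine p v = (fun t : ℂ => p + t • v) '' Metric.ball 0 r := by
  ext x
  constructor
  · rintro ⟨hx, t, rfl⟩
    exact ⟨t, by simpa [norm_smul, hv] using hx, rfl⟩
  · rintro ⟨t, ht, rfl⟩
    exact ⟨by simpa [norm_smul, hv] using ht, t, rfl⟩

theorem closedBall_inter_complexLine (hv : ‖v‖ = 1) (r : ℝ) :
    Metric.closedBall p r ∩ complexLine p v =
      (fun t : ℂ => p + t • v) '' Metric.closedBall 0 r := by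
  ext x
  constructor
  · rintro ⟨hx, t, rfl⟩
    exact ⟨t, by simpa [norm_smul, hv] using hx, rfl⟩
  · rintro ⟨t, ht, rfl⟩
    exact ⟨by simpa [norm_smul, hv] using ht, t, rfl⟩

/-- On some complex line through the center of a ball, the modulus attains its maximum over the
closed ball. -/
theorem exists_line_forall_norm_le [ProperSpace E] [Nontrivial E] {F : Type*}
    [SeminormedAddCommGroup F] {R : E → F} {r : ℝ} (hr : 0 ≤ r)
    (hR : ContinuousOn R (Metric.closedBall p r)) :
    ∃ (v : E) (t : ℂ), ‖v‖ = 1 ∧ ‖t‖ ≤ r ∧ ∀ x ∈ Metric.closedBall p r, ‖R x‖ ≤ ‖R (p + t • v)‖ := by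
  obtain ⟨q, hq, hmax⟩ := (isCompact_closedBall p r).exists_isMaxOn
    ⟨p, Metric.mem_closedBall_self hr⟩ hR.norm
  -- If the maximum is attained at the center, any direction serves.
  rcases eq_or_ne q p with rfl | hqp
  · obtain ⟨v, hv⟩ := exists_norm_eq E zero_le_one
    exact ⟨v, 0, hv, by simpa using hr, fun x hx => by simpa using hmax hx⟩
  · have hn : ‖q - p‖ ≠ 0 := norm_ne_zero_iff.2 (sub_ne_zero.2 hqp)
    refine ⟨((‖q - p‖ : ℂ)⁻¹) • (q - p), ‖q - p‖, ?_, ?_, fun x hx => ?_⟩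
    · rw [norm_smul, norm_inv, Complex.norm_of_nonneg (norm_nonneg _), inv_mul_cancel₀ hn]
    · rw [Complex.norm_of_nonneg (norm_nonneg _), ← dist_eq_norm]
      exact hq
    · rw [smul_inv_smul₀ (Complex.ofReal_ne_zero.2 hn), add_sub_cancel]
      exact hmax hx

end Line

/-- The Bernstein index along one line bounds the index of the ball from below. -/
theorem ofReal_log_le_gapBernsteinIndex {n : ℕ} {p v : EuclideanSpace ℂ (Fin n)} {r : ℝ}
    {R : EuclideanSpace ℂ (Fin n) → ℂ} (hr : 0 < r) (hv : ‖v‖ = 1)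
    (hne : ∃ t ∈ Metric.ball (0 : ℂ) r, R (p + t • v) ≠ 0) {t₀ t₁ : ℂ}
    (ht₀ : ‖t₀‖ ≤ r) (h₀ : ∀ t : ℂ, ‖t‖ ≤ r → ‖R (p + t • v)‖ ≤ ‖R (p + t₀ • v)‖)
    (ht₁ : ‖t₁‖ ≤ r / 2) (h₁ : ∀ t : ℂ, ‖t‖ ≤ r / 2 → ‖R (p + t • v)‖ ≤ ‖R (p + t₁ • v)‖) :
    ENNReal.ofReal (Real.log (‖R (p + t₀ • v)‖ / ‖R (p + t₁ • v)‖)) ≤ gapBernsteinIndex 2 p r R := by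
  have hemb : Topology.IsClosedEmbedding fun t : ℂ => p + t • v :=
    (isometry_add_smul hv).isClosedEmbedding
  have hball : maxModulus (Metric.ball p r ∩ complexLine p v) R = ‖R (p + t₀ • v)‖ := by
    rw [ball_inter_complexLine hv, maxModulus_image hemb]
    refine maxModulus_eq_of_isMaxOn (f := R ∘ fun t : ℂ => p + t • v) ?_ ?_
    · simpa [closure_ball (0 : ℂ) hr.ne'] using ht₀
    · intro t ht
      exact h₀ t (by simpa [closure_ball (0 : ℂ) hr.ne'] using ht)
  have hcball : maxModulus (Metric.closedBall p (r / 2) ∩ complexLine p v) R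
      = ‖R (p + t₁ • v)‖ := by
    rw [closedBall_inter_complexLine hv, maxModulus_image hemb]
    refine maxModulus_eq_of_isMaxOn (f := R ∘ fun t : ℂ => p + t • v) ?_ ?_
    · simpa [Metric.isClosed_closedBall.closure_eq] using ht₁
    · intro t ht
      exact h₁ t (by simpa [Metric.isClosed_closedBall.closure_eq] using ht)
  have hex : ∃ x ∈ Metric.ball p r ∩ complexLine p v, R x ≠ 0 := by
    obtain ⟨t, ht, hRt⟩ := hne
    exact ⟨p + t • v, by rw [ball_inter_complexLine hv]; exact ⟨t, ht, rfl⟩, hRt⟩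
  have hv0 : v ≠ 0 := norm_ne_zero_iff.1 (hv ▸ one_ne_zero)
  refine le_iSup_of_le v (le_iSup_of_le hv0 (le_iSup_of_le hex ?_))
  rw [bernsteinIndex, hball, hcball]

/-! ### Polydiscs around a line and their fibres. -/

open Metric Set in
/-- A bounded holomorphic function varies slowly inside a ball. -/
theorem norm_add_sub_le_of_norm_le {E : Type*} [NormedAddCommGroup E] [NormedSpace ℂ E]
    {R : E → ℂ} {p q ζ : E} {r M : ℝ} (hr : 0 < r)
    (hR : AnalyticOnNhd ℂ R (closedBall p r)) (hM : ∀ x ∈ closedBall p r, ‖R x‖ ≤ M)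
    (hq : ‖q - p‖ ≤ r / 2) (hζ : ‖ζ‖ < r / 2) :
    ‖R (q + ζ) - R q‖ ≤ 4 * M / r * ‖ζ‖ := by
  have hsub : ball q (r / 2) ⊆ closedBall p r := fun x hx => by
    rw [mem_ball] at hx
    rw [← dist_eq_norm] at hq
    exact mem_closedBall.2 ((dist_triangle x q p).trans (by linarith))
  -- Schwarz lemma on the ball of radius `r/2` about `q`, where `R` stays within `2 M` of `R q`.
  have h := Complex.dist_le_div_mul_dist_of_mapsTo_ball (f := R) (c := q) (R₁ := r / 2)
    (R₂ := 2 * M) (z := q + ζ) (fun x hx => (hR x (hsub hx)).differentiableAt.differentiableWithinAt)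
    (fun x hx => by
      rw [mem_closedBall, dist_eq_norm]
      refine (norm_sub_le _ _).trans ?_
      have := hM x (hsub hx)
      have := hM q (hsub (mem_ball_self (by linarith)))
      linarith)
    (by simpa using hζ)
  rw [dist_eq_norm, dist_eq_norm, add_sub_cancel_left] at h
  refine h.trans_eq ?_
  field_simp
  ring

/-- The polydisc centered at `p`, with all the radii of the base equal to `δ` and the radius of the
fiber equal to `ρ`, in the coordinates given by an orthonormal basis. -/
noncomputable def OrthonormalBasis.stdPolydisc {n m : ℕ}
    (β : OrthonormalBasis (Fin m ⊕ Fin 1) ℂ (EuclideanSpace ℂ (Fin n)))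
    (p : EuclideanSpace ℂ (Fin n)) {δ ρ : ℝ} (hδ : 0 < δ) (hρ : 0 < ρ) : StdPolydisc n m 1 where
  coord := (AffineIsometryEquiv.vaddConst ℂ p).symm.trans β.repr.toAffineIsometryEquiv
  zCenter := 0
  wCenter := 0
  zRadius _ := δ
  wRadius _ := ρ
  zRadius_pos _ := hδ
  wRadius_pos _ := hρ

namespace OrthonormalBasis

variable {n m : ℕ} (β : OrthonormalBasis (Fin m ⊕ Fin 1) ℂ (EuclideanSpace ℂ (Fin n)))
  (p : EuclideanSpace ℂ (Fin n)) {δ ρ : ℝ} (hδ : 0 < δ) (hρ : 0 < ρ)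

theorem stdPolydisc_coord (x : EuclideanSpace ℂ (Fin n)) :
    (β.stdPolydisc p hδ hρ).coord x = β.repr (x - p) := rfl

theorem stdPolydisc_point_projZ_projW (x : EuclideanSpace ℂ (Fin n)) :
    (β.stdPolydisc p hδ hρ).point ((β.stdPolydisc p hδ hρ).projZ x)
      (fun _ => (β.stdPolydisc p hδ hρ).projW x 0) = x := by
  rw [StdPolydisc.point, AffineIsometryEquiv.symm_apply_eq]
  ext i
  rcases i with i | i
  · rfl
  · rw [Subsingleton.elim i 0]; rfl

/-- The point with coordinates `z × 0`, as a vector with origin `p`. -/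
noncomputable def baseVector (z : Fin m → ℂ) : EuclideanSpace ℂ (Fin n) := ∑ i, z i • β (Sum.inl i)

theorem stdPolydisc_point (z : Fin m → ℂ) (w : ℂ) :
    (β.stdPolydisc p hδ hρ).point z (fun _ => w) =
      p + w • β (Sum.inr 0) + β.baseVector z := by
  rw [StdPolydisc.point, AffineIsometryEquiv.symm_apply_eq, stdPolydisc_coord, add_assoc,
    add_sub_cancel_left, ← LinearIsometryEquiv.symm_apply_eq, ← β.sum_repr_symm,
    Fintype.sum_sum_type]
  simp [baseVector, add_comm]

/-- The triangle inequality over `m` coordinates; `m + 1` in place of `m` keeps the radius positive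
when `m = 0`. -/
theorem norm_baseVector_le {z : Fin m → ℂ} {ε : ℝ} (hε : 0 ≤ ε) (hz : ∀ i, ‖z i‖ ≤ ε / (m + 1)) :
    ‖β.baseVector z‖ ≤ ε := by
  calc ‖β.baseVector z‖ ≤ ∑ i, ‖z i • β (Sum.inl i)‖ := norm_sum_le _ _
    _ ≤ ∑ _i : Fin m, ε / (m + 1) := Finset.sum_le_sum fun i _ => by
        rw [norm_smul, β.norm_eq_one, mul_one]; exact hz i
    _ = m / (m + 1) * ε := by
        rw [Finset.sum_const, Finset.card_univ, Fintype.card_fin, nsmul_eq_mul]; ring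
    _ ≤ ε := mul_le_of_le_one_left hε ((div_le_one (by positivity)).2 (by linarith))

theorem stdPolydisc_base :
    (β.stdPolydisc p hδ hρ).base = {z : Fin m → ℂ | ∀ i, ‖z i‖ < δ} := by
  simp [StdPolydisc.base, stdPolydisc]

theorem stdPolydisc_fiber :
    (β.stdPolydisc p hδ hρ).fiber = {w : Fin 1 → ℂ | ‖w 0‖ < ρ} := by
  simp [StdPolydisc.fiber, stdPolydisc]

theorem closure_stdPolydisc_base_subset :
    closure (β.stdPolydisc p hδ hρ).base ⊆ {z : Fin m → ℂ | ∀ i, ‖z i‖ ≤ δ} := by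
  rw [stdPolydisc_base]
  refine closure_minimal (fun z hz i => (hz i).le) ?_
  simp only [Set.ofPred_forall]
  exact isClosed_iInter fun i => isClosed_le (by fun_prop) continuous_const

theorem frontier_stdPolydisc_fiber_subset :
    frontier (β.stdPolydisc p hδ hρ).fiber ⊆ {w : Fin 1 → ℂ | ‖w 0‖ = ρ} := by
  rw [stdPolydisc_fiber]
  exact frontier_lt_subset_eq (by fun_prop) continuous_const

end OrthonormalBasis

theorem StdPolydisc.projZ_point {n m k : ℕ} (Δ : StdPolydisc n m k) (z : Fin m → ℂ)
    (w : Fin k → ℂ) : Δ.projZ (Δ.point z w) = z := by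
  funext i
  simp [projZ, point]

theorem StdPolydisc.projW_point {n m k : ℕ} (Δ : StdPolydisc n m k) (z : Fin m → ℂ)
    (w : Fin k → ℂ) : Δ.projW (Δ.point z w) = w := by
  funext j
  simp [projW, point]

namespace OrthonormalBasis

open Metric Set

variable {n m : ℕ} (β : OrthonormalBasis (Fin m ⊕ Fin 1) ℂ (EuclideanSpace ℂ (Fin n)))
  (p : EuclideanSpace ℂ (Fin n)) {δ ρ : ℝ} (hδ : 0 < δ) (hρ : 0 < ρ)

theorem ball_subset_stdPolydisc_carrier (hδρ : δ ≤ ρ) :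
    ball p δ ⊆ (β.stdPolydisc p hδ hρ).carrier := by
  intro x hx
  rw [mem_ball, dist_eq_norm] at hx
  have hcoord : ∀ i, ‖β.repr (x - p) i‖ < δ := fun i =>
    ((PiLp.norm_apply_le _ i).trans_eq (β.repr.norm_map _)).trans_lt hx
  refine ⟨?_, ?_⟩
  · rw [stdPolydisc_base]
    exact fun i => hcoord (Sum.inl i)
  · rw [stdPolydisc_fiber]
    exact (hcoord (Sum.inr 0)).trans_le hδρ

theorem stdPolydisc_carrier_subset_closedBall {ε : ℝ} (hε : 0 ≤ ε) (hδε : δ = ε / (m + 1)) :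
    (β.stdPolydisc p hδ hρ).carrier ⊆ closedBall p (ρ + ε) := by
  rintro x ⟨hz, hw⟩
  rw [stdPolydisc_base] at hz
  rw [stdPolydisc_fiber] at hw
  rw [mem_closedBall, dist_eq_norm, ← β.stdPolydisc_point_projZ_projW p hδ hρ x, stdPolydisc_point,
    add_assoc, add_sub_cancel_left]
  refine (norm_add_le _ _).trans (add_le_add ?_ (β.norm_baseVector_le hε fun i => ?_))
  · rw [norm_smul, β.norm_eq_one, mul_one]
    exact hw.le
  · rw [← hδε]
    exact (hz i).le

end OrthonormalBasis

open Metric Set in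
/-- The set of zeros of a function is spread over the base of a polydisc with no more points in a
fiber than there are zeros counted with multiplicity. -/
theorem OrthonormalBasis.stdPolydisc_degree_le {n m : ℕ}
    (β : OrthonormalBasis (Fin m ⊕ Fin 1) ℂ (EuclideanSpace ℂ (Fin n)))
    (p : EuclideanSpace ℂ (Fin n)) {δ ρ : ℝ} (hδ : 0 < δ) (hρ : 0 < ρ)
    {Ω : Set (EuclideanSpace ℂ (Fin n))} {R : EuclideanSpace ℂ (Fin n) → ℂ} {e : ℕ}
    (hR : AnalyticOnNhd ℂ R (β.stdPolydisc p hδ hρ).carrier)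
    (he : (β.stdPolydisc p hδ hρ).HasCycleDegree R e) :
    (β.stdPolydisc p hδ hρ).degree (Ω ∩ {x | R x = 0}) ≤ e := by
  classical
  set Δ := β.stdPolydisc p hδ hρ
  refine iSup₂_le fun z hz => ?_
  have han : AnalyticOnNhd ℂ (fun w => R (Δ.point z fun _ => w)) {w | (fun _ => w) ∈ Δ.fiber} :=
    fun w hw => by
      have hmem : Δ.point z (fun _ => w) ∈ Δ.carrier := by
        rw [StdPolydisc.carrier, mem_ofPred_eq, StdPolydisc.projZ_point, StdPolydisc.projW_point]
        exact ⟨hz, hw⟩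
      have h1 := hR _ hmem
      simp only [Δ, stdPolydisc_point] at h1 ⊢
      exact h1.comp (f := fun w : ℂ => p + w • β (Sum.inr 0) + β.baseVector z) (by fun_prop)
  obtain ⟨s, hs, hse⟩ := (he z hz).exists_card_le han
  have hsub : Ω ∩ {x | R x = 0} ∩ Δ.carrier ∩ {x | Δ.projZ x = z} ⊆
      (fun w => Δ.point z fun _ => w) '' s := by
    rintro x ⟨⟨⟨-, hx⟩, hxΔ⟩, rfl⟩
    have hpt := β.stdPolydisc_point_projZ_projW p hδ hρ x
    refine ⟨Δ.projW x 0, (hs _).2 ⟨?_, ?_⟩, hpt⟩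
    · have : (fun _ => Δ.projW x 0) = Δ.projW x := funext fun j => by rw [Subsingleton.elim j 0]
      rw [mem_ofPred_eq, this]
      exact hxΔ.2
    · exact (congrArg R hpt).trans hx
  calc _ ≤ ((fun w => Δ.point z fun _ => w) '' (s : Set ℂ)).encard := encard_le_encard hsub
    _ ≤ (s : Set ℂ).encard := encard_image_le _ _
    _ = s.card := encard_coe_eq_coe_finsetCard s
    _ ≤ e := by exact_mod_cast hse

open Metric Set in
/-- A polydisc around a circle on which `R` is not small is a Weierstrass polydisc, if its base is
small enough, and its degree is the number of zeros inside the circle. -/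
theorem OrthonormalBasis.isWeierstrass_stdPolydisc {n m : ℕ}
    (β : OrthonormalBasis (Fin m ⊕ Fin 1) ℂ (EuclideanSpace ℂ (Fin n)))
    {p : EuclideanSpace ℂ (Fin n)} {r ρ M κ ε δ : ℝ} {R : EuclideanSpace ℂ (Fin n) → ℂ} {e : ℕ}
    (hr : 0 < r) (hR : AnalyticOnNhd ℂ R (closedBall p r)) (hM : 0 < M)
    (hRM : ∀ x ∈ closedBall p r, ‖R x‖ ≤ M) (hρ : 0 < ρ) (hρr : ρ ≤ r / 2)
    (hcirc : ∀ w : ℂ, ‖w‖ = ρ → M * κ ≤ ‖R (p + w • β (Sum.inr 0))‖)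
    (hε : 0 < ε) (hεκ : ε ≤ r / 8 * κ) (hκ : κ ≤ 1) (hδ : 0 < δ) (hδε : δ = ε / (m + 1))
    (he : HasZeroCount (fun w => R (p + w • β (Sum.inr 0))) (ball 0 ρ) e) :
    (β.stdPolydisc p hδ hρ).IsWeierstrass (ball p r) (ball p r ∩ {x | R x = 0}) ∧
      (β.stdPolydisc p hδ hρ).carrier ⊆ ball p r ∧ (β.stdPolydisc p hδ hρ).HasCycleDegree R e := by
  have hεr : ε ≤ r / 8 := hεκ.trans (mul_le_of_le_one_right (by positivity) hκ)
  have hcar := β.stdPolydisc_carrier_subset_closedBall p hδ hρ hε.le hδε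
  have hcb : closedBall p (ρ + ε) ⊆ ball p r := closedBall_subset_ball (by linarith)
  -- Moving off the line by `ε ≤ r κ / 8` changes `R` by at most `M κ / 2`, half the lower bound on
  -- the circle. This gives both the absence of zeros over the circle and the hypothesis of Rouché.
  have hnear : ∀ (z : Fin m → ℂ) (w : ℂ), (∀ i, ‖z i‖ ≤ δ) → ‖w‖ = ρ →
      ‖R (p + w • β (Sum.inr 0) + β.baseVector z) - R (p + w • β (Sum.inr 0))‖
        < ‖R (p + w • β (Sum.inr 0))‖ := fun z w hz hw => by
    have hb := β.norm_baseVector_le hε.le fun i => (hz i).trans_eq hδε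
    have h1 := norm_add_sub_le_of_norm_le (q := p + w • β (Sum.inr 0)) (ζ := β.baseVector z) hr hR
      hRM (by rw [add_sub_cancel_left, norm_smul, β.norm_eq_one, mul_one, hw]; exact hρr)
      (by linarith)
    have hκ0 : 0 < κ := pos_of_mul_pos_right (hε.trans_le hεκ) (by positivity)
    calc _ ≤ 4 * M / r * ‖β.baseVector z‖ := h1
      _ ≤ 4 * M / r * (r / 8 * κ) := by gcongr; exact hb.trans hεκ
      _ = M * κ / 2 := by field_simp; ring
      _ < M * κ := half_lt_self (by positivity)
      _ ≤ _ := hcirc w hw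
  have hmem : ∀ (z : Fin m → ℂ) (w : ℂ), (∀ i, ‖z i‖ ≤ δ) → ‖w‖ ≤ ρ →
      p + w • β (Sum.inr 0) + β.baseVector z ∈ closedBall p r := fun z w hz hw => by
    rw [mem_closedBall, dist_eq_norm, add_assoc, add_sub_cancel_left]
    refine (norm_add_le _ _).trans ?_
    rw [norm_smul, β.norm_eq_one, mul_one]
    have := β.norm_baseVector_le hε.le fun i => (hz i).trans_eq hδε
    linarith
  have han : ∀ z : Fin m → ℂ, (∀ i, ‖z i‖ ≤ δ) →
      AnalyticOnNhd ℂ (fun w : ℂ => R (p + w • β (Sum.inr 0) + β.baseVector z)) (closedBall 0 ρ) :=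
    fun z hz w hw => (hR _ (hmem z w hz (mem_closedBall_zero_iff.1 hw))).comp
      (f := fun w : ℂ => p + w • β (Sum.inr 0) + β.baseVector z) (by fun_prop)
  refine ⟨⟨(closure_minimal hcar isClosed_closedBall).trans hcb, ?_⟩, hcar.trans hcb, ?_⟩
  · rw [eq_empty_iff_forall_notMem]
    rintro x ⟨⟨hz, hw⟩, -, hx⟩
    have h := hnear _ _ (β.closure_stdPolydisc_base_subset p hδ hρ hz)
      (β.frontier_stdPolydisc_fiber_subset p hδ hρ hw)
    rw [← stdPolydisc_point β p hδ hρ, stdPolydisc_point_projZ_projW, show R x = 0 from hx,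
      zero_sub, norm_neg] at h
    exact lt_irrefl _ h
  · intro z hz
    rw [stdPolydisc_base] at hz
    have hset : {w : ℂ | (fun _ => w) ∈ (β.stdPolydisc p hδ hρ).fiber} = ball 0 ρ := by
      ext w
      rw [stdPolydisc_fiber, mem_ball_zero_iff]
      rfl
    rw [hset]
    simp only [stdPolydisc_point]
    refine HasZeroCount.of_norm_sub_lt_norm hρ ?_ (han z fun i => (hz i).le)
      (fun w hw => hnear z w (fun i => (hz i).le) (mem_sphere_zero_iff_norm.1 hw)) he
    have h0 := han 0 fun i => by simpa using hδ.le
    simpa [baseVector] using h0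

/-! ### Choice of the line and of the constants. -/

theorem EuclideanSpace.exists_orthonormalBasis_sum_apply_inr {m : ℕ}
    {v : EuclideanSpace ℂ (Fin (m + 1))} (hv : ‖v‖ = 1) :
    ∃ β : OrthonormalBasis (Fin m ⊕ Fin 1) ℂ (EuclideanSpace ℂ (Fin (m + 1))),
      β (Sum.inr 0) = v := by
  have horth : Orthonormal ℂ (({Sum.inr 0} : Set (Fin m ⊕ Fin 1)).domRestrict fun _ => v) :=
    ⟨fun _ => hv, fun i j hij => absurd (Subsingleton.elim i j) hij⟩
  obtain ⟨β, hβ⟩ := horth.exists_orthonormalBasis_extension_of_card_eq (by simp)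
  exact ⟨β, hβ _ rfl⟩

theorem mainTheorem9 :
    ∃ A : ℝ≥0, ∀ m : ℕ, ∃ C : ℝ≥0,
      ∀ (p : EuclideanSpace ℂ (Fin (m + 1))) (r : ℝ) (R : EuclideanSpace ℂ (Fin (m + 1)) → ℂ),
        0 < r →
        AnalyticOnNhd ℂ R (Metric.closedBall p r) →
        (∃ x ∈ Metric.ball p r, R x ≠ 0) →
        ∃ (Δ : StdPolydisc (m + 1) m 1) (η : ℝ),
          Δ.IsWeierstrass (Metric.ball p r) (Metric.ball p r ∩ {x | R x = 0}) ∧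
          1 < η ∧
          ENNReal.ofReal (Real.log η) ≤ C * (1 + gapBernsteinIndex 2 p r R) ∧
          Metric.ball p (r / η) ⊆ Δ.carrier ∧
          Δ.carrier ⊆ Metric.ball p r ∧
          ((Δ.degree (Metric.ball p r ∩ {x | R x = 0}) : ℕ∞) : ℝ≥0∞)
            ≤ A * gapBernsteinIndex 2 p r R ∧
          ∃ e : ℕ, Δ.HasCycleDegree R e ∧ (e : ℝ≥0∞) ≤ A * gapBernsteinIndex 2 p r R := by
  have hlog : 0 < Real.log (11 / 10) := Real.log_pos (by norm_num)
  set c : ℝ := 25 + Real.log 32 / Real.log (11 / 10) with hc_def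
  have hc : 0 ≤ c := by
    have := Real.log_nonneg (by norm_num : (1 : ℝ) ≤ 32)
    positivity
  refine ⟨(Real.log (11 / 10))⁻¹.toNNReal, fun m => ⟨(Real.log (8 * (m + 1)) + c).toNNReal,
    fun p r R hr hR hne => ?_⟩⟩
  obtain ⟨v, t₀, hv, ht₀, hmax⟩ := exists_line_forall_norm_le hr.le hR.continuousOn
  obtain ⟨β, rfl⟩ := EuclideanSpace.exists_orthonormalBasis_sum_apply_inr hv
  set v := β (Sum.inr 0)
  set f : ℂ → ℂ := fun t => R (p + t • v) with hf_def
  set M := ‖R (p + t₀ • v)‖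
  have hM : 0 < M := by
    obtain ⟨x, hx, hRx⟩ := hne
    exact (norm_pos_iff.2 hRx).trans_le (hmax x (Metric.ball_subset_closedBall hx))
  have hline : ∀ t : ℂ, ‖t‖ ≤ r → p + t • v ∈ Metric.closedBall p r := fun t ht => by
    simpa [norm_smul, hv] using ht
  have hf : AnalyticOnNhd ℂ f (Metric.closedBall 0 r) := fun t ht =>
    (hR _ (hline t (mem_closedBall_zero_iff.1 ht))).comp (f := fun t : ℂ => p + t • v) (by fun_prop)
  have hfM : ∀ t ∈ Metric.closedBall (0 : ℂ) r, ‖f t‖ ≤ M := fun t ht =>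
    hmax _ (hline t (mem_closedBall_zero_iff.1 ht))
  have hhalf : Metric.closedBall (0 : ℂ) (r / 2) ⊆ Metric.closedBall 0 r :=
    Metric.closedBall_subset_closedBall (by linarith)
  obtain ⟨t₁, ht₁, hmax₁⟩ := (isCompact_closedBall (0 : ℂ) (r / 2)).exists_isMaxOn
    ⟨0, Metric.mem_closedBall_self (by positivity)⟩ (hf.continuousOn.mono hhalf).norm
  -- Otherwise `f` vanishes on the half disc, hence on the whole disc, contradicting `M > 0`. Thus
  -- `b` is finite even if `𝔅 = ∞`.
  have hf₁ : f t₁ ≠ 0 := fun h0 => by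
    refine norm_pos_iff.1 hM (hf.eqOn_zero_of_preconnected_of_eventuallyEq_zero
      (convex_closedBall (0 : ℂ) r).isPreconnected (Metric.mem_closedBall_self hr.le) ?_
      (mem_closedBall_zero_iff.2 ht₀))
    filter_upwards [Metric.closedBall_mem_nhds (0 : ℂ) (half_pos hr)] with t ht
    have := hmax₁ ht
    simpa [h0] using this
  set b := Real.log (M / ‖f t₁‖) with hb_def
  have hb : Real.exp (-b) * M = ‖f t₁‖ := by
    rw [hb_def, Real.exp_neg, Real.exp_log (by positivity), inv_div, div_mul_cancel₀ _ hM.ne']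
  have hb0 : 0 ≤ b := Real.log_nonneg
    ((one_le_div (norm_pos_iff.2 hf₁)).2 (hfM t₁ (hhalf ht₁)))
  have hbB : ENNReal.ofReal b ≤ gapBernsteinIndex 2 p r R := by
    refine ofReal_log_le_gapBernsteinIndex hr hv ⟨t₁, ?_, hf₁⟩ ht₀
      (fun t ht => hmax _ (hline t ht)) (mem_closedBall_zero_iff.1 ht₁)
      fun t ht => hmax₁ (mem_closedBall_zero_iff.2 ht)
    rw [mem_ball_zero_iff]
    linarith [mem_closedBall_zero_iff.1 ht₁]
  obtain ⟨ρ, hρ, hcirc, hcount⟩ := exists_circle_exp_mul_le_norm hr hM hf hfM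
    (mem_closedBall_zero_iff.1 ht₁) hb.le
  have hρ0 : 0 < ρ := by linarith [hρ.1]
  have hρr : Metric.closedBall (0 : ℂ) ρ ⊆ Metric.closedBall 0 r :=
    Metric.closedBall_subset_closedBall (by linarith [hρ.2])
  obtain ⟨e, he, -⟩ := exists_hasZeroCount_of_ne_zero_on_sphere hρ0 (fun w hw => hf w (hρr hw))
    fun w hw h0 => by
      have := hcirc w (mem_sphere_zero_iff_norm.1 hw)
      rw [h0, norm_zero] at this
      exact absurd this (not_le.2 (by positivity))
  have heb := hcount e he
  set κ := Real.exp (-(c * b))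
  have hκ0 : 0 < κ := Real.exp_pos _
  have hκ1 : κ ≤ 1 := Real.exp_le_one_iff.2 (by have := mul_nonneg hc hb0; linarith)
  -- The largest base radius allowed by the Schwarz estimate. The ball of radius `δ` lies in the
  -- polydisc, so `η = r / δ = 8 (m + 1) exp (c b)`.
  set δ := r / 8 * κ / (m + 1) with hδ_def
  have hδ : 0 < δ := by positivity
  have hδρ : δ ≤ ρ := by
    calc δ ≤ r / 8 * κ := div_le_self (by positivity) (by linarith [(Nat.cast_nonneg m : (0 : ℝ) ≤ m)])
      _ ≤ r / 8 := mul_le_of_le_one_right (by positivity) hκ1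
      _ ≤ ρ := by linarith [hρ.1]
  obtain ⟨hW, hsub, hdeg⟩ := β.isWeierstrass_stdPolydisc hr hR hM hmax hρ0 hρ.2 hcirc
    (by positivity) le_rfl hκ1 hδ hδ_def he
  have heA : (e : ℝ≥0∞) ≤ (Real.log (11 / 10))⁻¹.toNNReal * gapBernsteinIndex 2 p r R := by
    calc (e : ℝ≥0∞) = ENNReal.ofReal e := (ENNReal.ofReal_natCast e).symm
      _ ≤ ENNReal.ofReal ((Real.log (11 / 10))⁻¹ * b) := ENNReal.ofReal_le_ofReal (by
          rwa [le_inv_mul_iff₀ hlog, mul_comm])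
      _ = (Real.log (11 / 10))⁻¹.toNNReal * ENNReal.ofReal b :=
          ENNReal.ofReal_mul (inv_nonneg.2 hlog.le)
      _ ≤ _ := by gcongr
  have hη : r / δ = 8 * (m + 1) * Real.exp (c * b) := by
    rw [hδ_def, show κ = (Real.exp (c * b))⁻¹ from Real.exp_neg _]
    field_simp
  have hm : (1 : ℝ) ≤ m + 1 := by linarith [(Nat.cast_nonneg m : (0 : ℝ) ≤ m)]
  refine ⟨β.stdPolydisc p hδ hρ0, r / δ, hW, ?_, ?_, ?_, hsub, ?_, e, hdeg, heA⟩
  · rw [one_lt_div hδ]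
    linarith [hρ.2]
  · have hlogm : 0 ≤ Real.log (8 * (m + 1)) := Real.log_nonneg (by linarith)
    rw [hη, Real.log_mul (by positivity) (Real.exp_pos _).ne', Real.log_exp]
    calc ENNReal.ofReal (Real.log (8 * (m + 1)) + c * b)
        ≤ ENNReal.ofReal ((Real.log (8 * (m + 1)) + c) * (1 + b)) :=
          ENNReal.ofReal_le_ofReal (by nlinarith [mul_nonneg hlogm hb0])
      _ = (Real.log (8 * (m + 1)) + c).toNNReal * (1 + ENNReal.ofReal b) := by
          rw [ENNReal.ofReal_mul (by positivity), ENNReal.ofReal_add zero_le_one hb0,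
            ENNReal.ofReal_one]
          rfl
      _ ≤ _ := by gcongr
  · rw [div_div_cancel₀ hr.ne']
    exact β.ball_subset_stdPolydisc_carrier p hδ hρ0 hδρ
  · refine le_trans ?_ heA
    have := β.stdPolydisc_degree_le p hδ hρ0 (Ω := Metric.ball p r)
      (fun x hx => hR x (Metric.ball_subset_closedBall (hsub hx))) hdeg
    exact_mod_cast ENat.toENNReal_le.2 this
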